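/- Let $n\ge 0$ and $k\ge 0$ be integers and let $[n]=\{1,2,\dots,n\}$. For a set partition $P$ of $[n]$, an \emph{arc} of $P$ is a pair $(i,j)$ with $i<j$ such that $i$ and $j$ lie in the same block of $P$ and no element $m$ of that block satisfies $i<m<j$. For $r\ge 1$, an \emph{$r$-crossing} of $P$ is a set of $r$ arcs $(i_1,j_1),\dots,(i_r,j_r)$ of $P$ with $i_1<i_2<\cdots<i_r<j_1<j_2<\cdots<j_r$, and an \emph{$r$-nesting} of $P$ is a set of $r$ arcs $(i_1,j_1),\dots,(i_r,j_r)$ of $P$ with $i_1<i_2<\cdots<i_r<j_r<\cdots<j_2<j_1$. Let $\mathrm{cr}(P)$ (respectively $\mathrm{ne}(P)$) be the maximal $r$ such that $P$ has an $r$-crossing (respectively an $r$-nesting), and $0$ if $P$ has no arcs. Call $P$ \emph{$k$-noncrossing} if $\mathrm{cr}(P)<k$ and \emph{$k$-nonnesting} if $\mathrm{ne}(P)<k$. Then the number $\mathrm{NC}_k(n)$ of $k$-noncrossing partitions of $[n]$ equals the number $\mathrm{NN}_k(n)$ of $k$-nonnesting partitions of $[n]$. -/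

import Mathlib

namespace SetPartition

/-- The set `[n] = {1, 2, …, n}`. -/
abbrev bracket (n : ℕ) : Finset ℕ := Finset.Icc 1 n

/-- The set of arcs in the standard representation of a partition `P` of `[n]`: the pairs `(i, j)`
with `i < j` that are consecutive elements, in numerical order, of some block of `P`. -/
def arcs {n : ℕ} (P : Finpartition (bracket n)) : Finset (ℕ × ℕ) :=
  (bracket n ×ˢ bracket n).filter fun e =>
    e.1 < e.2 ∧ ∃ B ∈ P.parts, e.1 ∈ B ∧ e.2 ∈ B ∧ ∀ m ∈ B, ¬ (e.1 < m ∧ m < e.2)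

/-- `P` has a `k`-crossing: there are `k` arcs `(i₁, j₁), …, (iₖ, jₖ)` of `P` with
`i₁ < i₂ < ⋯ < iₖ < j₁ < j₂ < ⋯ < jₖ`. -/
def HasCrossing {n : ℕ} (P : Finpartition (bracket n)) (k : ℕ) : Prop :=
  ∃ i j : Fin k → ℕ, (∀ r, (i r, j r) ∈ arcs P) ∧
    StrictMono i ∧ StrictMono j ∧ ∀ r s, i r < j s

/-- `P` has a `k`-nesting: there are `k` arcs `(i₁, j₁), …, (iₖ, jₖ)` of `P` with
`i₁ < i₂ < ⋯ < iₖ < jₖ < ⋯ < j₂ < j₁`. -/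
def HasNesting {n : ℕ} (P : Finpartition (bracket n)) (k : ℕ) : Prop :=
  ∃ i j : Fin k → ℕ, (∀ r, (i r, j r) ∈ arcs P) ∧
    StrictMono i ∧ StrictAnti j ∧ ∀ r s, i r < j s

/-- The crossing number: the maximal `k` such that `P` has a `k`-crossing. A single arc is a
`1`-crossing, and the value is `0` exactly when `P` has no arcs. The maximum exists, see
`isGreatest_cr`. -/
noncomputable def cr {n : ℕ} (P : Finpartition (bracket n)) : ℕ := sSup {k | HasCrossing P k}

/-- The nesting number: the maximal `k` such that `P` has a `k`-nesting. A single arc is a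
`1`-nesting, and the value is `0` exactly when `P` has no arcs. The maximum exists, see
`isGreatest_ne`. -/
noncomputable def ne {n : ℕ} (P : Finpartition (bracket n)) : ℕ := sSup {k | HasNesting P k}

/-- `k` arcs with distinct left endpoints in `[n]` exist only for `k ≤ n`. -/
theorem le_of_arcs {n k : ℕ} {P : Finpartition (bracket n)} {i j : Fin k → ℕ}
    (h : ∀ r, (i r, j r) ∈ arcs P) (hi : StrictMono i) : k ≤ n := by
  have := Finset.card_le_card_of_injOn (s := Finset.univ) (t := bracket n) i
    (fun r _ => (Finset.mem_product.1 (Finset.mem_filter.1 (h r)).1).1) hi.injective.injOn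
  simpa using this

theorem isGreatest_cr {n : ℕ} (P : Finpartition (bracket n)) :
    IsGreatest {k | HasCrossing P k} (cr P) := by
  have hb : BddAbove {k | HasCrossing P k} := ⟨n, fun k ⟨_, _, h, hi, _⟩ => le_of_arcs h hi⟩
  refine ⟨Nat.sSup_mem ⟨0, Fin.elim0, Fin.elim0, fun r => r.elim0, ?_, ?_, fun r => r.elim0⟩ hb,
    fun k hk => le_csSup hb hk⟩ <;> exact fun r => r.elim0

theorem isGreatest_ne {n : ℕ} (P : Finpartition (bracket n)) :
    IsGreatest {k | HasNesting P k} (ne P) := by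
  have hb : BddAbove {k | HasNesting P k} := ⟨n, fun k ⟨_, _, h, hi, _⟩ => le_of_arcs h hi⟩
  refine ⟨Nat.sSup_mem ⟨0, Fin.elim0, Fin.elim0, fun r => r.elim0, ?_, ?_, fun r => r.elim0⟩ hb,
    fun k hk => le_csSup hb hk⟩ <;> exact fun r => r.elim0

/-- `P` is `k`-noncrossing. -/
def IsNoncrossing {n : ℕ} (k : ℕ) (P : Finpartition (bracket n)) : Prop := cr P < k

/-- `P` is `k`-nonnesting. -/
def IsNonnesting {n : ℕ} (k : ℕ) (P : Finpartition (bracket n)) : Prop := ne P < k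

open Classical in
/-- The number of `k`-noncrossing partitions of `[n]`. -/
noncomputable def NC (k n : ℕ) : ℕ :=
  (Finset.univ.filter fun P : Finpartition (bracket n) => IsNoncrossing k P).card

open Classical in
/-- The number of `k`-nonnesting partitions of `[n]`. -/
noncomputable def NN (k n : ℕ) : ℕ :=
  (Finset.univ.filter fun P : Finpartition (bracket n) => IsNonnesting k P).card

end SetPartition

namespace SetPartition

/-! ### Local rules of growth diagrams -/

/-! Placing the arc `(i, j)` in the cell `(i - 1, n - j)` turns a set partition into a filling of a
staircase with at most one entry in each row and column, and every such filling arises. The arcs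
passing over the gap between `x` and `x + 1` fill the rectangle below the border corner `(x, n -
x)`. Nestings are increasing chains inside such a rectangle, crossings are decreasing ones.

Fomin's growth diagram attaches an integer partition to each corner. As in Schensted's theorem, its
first part is the length of the longest increasing chain in the rectangle (`le_grow_zero_iff`), and
its number of parts that of the longest decreasing chain (`grow_pos_iff`). The local rules are
invertible: the partitions along the border determine the filling (`grow_injective`), and every
border labelling by partitions that is empty on the axes and changes by at most one box per step
comes from a filling (`exists_grow_eq`).

Such labellings are stable under conjugation (`Adj.conj`), which exchanges the first part with the
number of parts. Conjugating the border is therefore an injection on set partitions exchanging `cr`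
and `ne`, and it yields both inequalities between the counts. -/

/-- `g` is `f`, or `f` with one box added. Partitions are given by their row lengths. -/
def Adj (f g : ℕ → ℕ) : Prop :=
  f = g ∨ ∃ p, ∀ r, g r = f r + if r = p then 1 else 0

theorem Adj.le {f g : ℕ → ℕ} (h : Adj f g) (r : ℕ) : f r ≤ g r := by
  rcases h with rfl | ⟨p, h⟩
  · exact le_rfl
  · rw [h]; omega

theorem Adj.le_succ {f g : ℕ → ℕ} (h : Adj f g) (r : ℕ) : g r ≤ f r + 1 := by
  rcases h with rfl | ⟨p, h⟩
  · omega
  · rw [h]; split_ifs <;> omega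

/-- A single box is a horizontal strip. This bound keeps the truncated subtractions in the local
rules exact. -/
theorem Adj.interlace {f g : ℕ → ℕ} (h : Adj f g) (hf : Antitone f) (hg : Antitone g) (r : ℕ) :
    g (r + 1) ≤ f r := by
  have h1 := hf (Nat.le_succ r)
  have h2 := hg (Nat.le_succ r)
  rcases h with rfl | ⟨p, h⟩
  · exact h1
  · have h3 := h r
    have h4 := h (r + 1)
    simp only [Nat.succ_eq_add_one] at h1 h2
    split_ifs at h3 h4 <;> omega

/-- The forward local rule, which computes the partition at the far corner of a cell with
entry `c`. -/
def fwd (l m v : ℕ → ℕ) (c : ℕ) : ℕ → ℕ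
  | 0 => max (m 0) (v 0) + c
  | r + 1 => max (m (r + 1)) (v (r + 1)) + (min (m r) (v r) - l r)

/-- The backward local rule. -/
def bwd (m v p : ℕ → ℕ) (r : ℕ) : ℕ :=
  min (m r) (v r) - (p (r + 1) - max (m (r + 1)) (v (r + 1)))

theorem fwd_comm (l m v : ℕ → ℕ) (c : ℕ) : fwd l m v c = fwd l v m c := by
  funext r
  cases r <;> simp [fwd, max_comm, min_comm]

theorem bwd_comm (m v p : ℕ → ℕ) : bwd m v p = bwd v m p := by
  funext r
  simp [bwd, max_comm, min_comm]

theorem bwd_fwd {l m v : ℕ → ℕ} {c : ℕ} (hm : ∀ r, l r ≤ m r) (hv : ∀ r, l r ≤ v r) :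
    bwd m v (fwd l m v c) = l := by
  funext r
  have := hm r
  have := hv r
  simp only [bwd, fwd]
  omega

theorem fwd_bwd {m v p : ℕ → ℕ} (hm : Adj m p) (hv : Adj v p) (am : Antitone m)
    (av : Antitone v) (ap : Antitone p) :
    fwd (bwd m v p) m v (p 0 - max (m 0) (v 0)) = p := by
  funext r
  cases r with
  | zero =>
    have := hm.le 0
    have := hv.le 0
    simp only [fwd]
    omega
  | succ r =>
    have := hm.le (r + 1)
    have := hv.le (r + 1)
    have := hm.interlace am ap r
    have := hv.interlace av ap r
    simp only [fwd, bwd]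
    omega

theorem fwd_antitone {l m v : ℕ → ℕ} {c : ℕ} (hm : Adj l m) (hv : Adj l v) (al : Antitone l)
    (am : Antitone m) (av : Antitone v) : Antitone (fwd l m v c) := by
  refine antitone_nat_of_succ_le fun r => ?_
  have h1 := hm.interlace al am r
  have h2 := hv.interlace al av r
  have h3 := hm.le r
  have h4 := hv.le r
  cases r with
  | zero => simp only [fwd]; omega
  | succ r => simp only [fwd] at *; omega

/-- Distinct added boxes are united, a common box in row `p` bumps a new one into row `p + 1`, and
an entry adds a box to row `0`. The last hypothesis prevents an entry from meeting any other change.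
-/
theorem adj_fwd {l m v : ℕ → ℕ} {c : ℕ} (hm : Adj l m) (hv : Adj l v) (hc : c ≤ 1)
    (h : c = 1 → m = l ∧ v = l) : Adj v (fwd l m v c) := by
  obtain rfl | rfl : c = 0 ∨ c = 1 := by omega
  · rcases hm with rfl | ⟨p, hp⟩
    · left
      funext r
      have := hv.le r
      cases r with
      | zero => simp only [fwd]; omega
      | succ r =>
        have := hv.le r
        simp only [fwd]; omega
    · rcases hv with rfl | ⟨q, hq⟩
      · right
        refine ⟨p, fun r => ?_⟩
        cases r with
        | zero => have := hp 0; simp only [fwd]; split_ifs at * <;> omega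
        | succ r =>
          have := hp r
          have := hp (r + 1)
          simp only [fwd]; split_ifs at * <;> omega
      · right
        by_cases hpq : p = q
        · subst hpq
          refine ⟨p + 1, fun r => ?_⟩
          cases r with
          | zero =>
            have := hp 0
            have := hq 0
            simp only [fwd]; split_ifs at * <;> omega
          | succ r =>
            have := hp r
            have := hp (r + 1)
            have := hq r
            have := hq (r + 1)
            simp only [fwd]; split_ifs at * <;> omega
        · refine ⟨p, fun r => ?_⟩
          cases r with
          | zero =>
            have := hp 0
            have := hq 0
            simp only [fwd]; split_ifs at * <;> omega
          | succ r =>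
            have := hp r
            have := hp (r + 1)
            have := hq r
            have := hq (r + 1)
            simp only [fwd]; split_ifs at * <;> omega
  · obtain ⟨rfl, rfl⟩ := h rfl
    right
    refine ⟨0, fun r => ?_⟩
    cases r with
    | zero => simp [fwd]
    | succ r => simp [fwd]

/-- A box of `m` outside `l` either is missing from `v` or is shared with `v` and bumps a box into
the next row. Both make the far corner larger than `v`. -/
theorem eq_of_fwd_eq {l m v : ℕ → ℕ} {c : ℕ} (hm : Adj l m) (hv : Adj l v)
    (h : v = fwd l m v c) : m = l ∧ c = 0 := by
  have h0 := congrFun h 0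
  simp only [fwd] at h0
  refine ⟨?_, by omega⟩
  rcases hm with rfl | ⟨p, hp⟩
  · rfl
  exfalso
  have h1 := congrFun h (p + 1)
  have h2 := congrFun h p
  have h3 := hp p
  have h4 := hv.le p
  simp only [fwd, if_true] at h1 h3
  have h5 : m p ≤ v p := by
    cases p with
    | zero => omega
    | succ p => simp only [fwd] at h2; omega
  omega

theorem adj_bwd {m v p : ℕ → ℕ} (hm : Adj m p) (hv : Adj v p) (am : Antitone m)
    (ap : Antitone p) : Adj (bwd m v p) m := by
  have key := fun r => hm.interlace am ap r
  rcases hm with rfl | ⟨i, hi⟩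
  · rcases hv with rfl | ⟨j, hj⟩
    · left; funext r; simp [bwd]
    · right
      refine ⟨j, fun r => ?_⟩
      have := hj r
      have := hj (r + 1)
      simp only [bwd]; split_ifs at * <;> omega
  · rcases hv with rfl | ⟨j, hj⟩
    · left
      funext r
      have := hi r
      have := hi (r + 1)
      simp only [bwd]; split_ifs at * <;> omega
    · by_cases hij : i = j
      · subst hij
        -- A common box in row `0` stems from an entry, so nothing is removed; one in row `i + 1`
        -- was bumped out of row `i`.
        cases i with
        | zero =>
          left
          funext r
          have := hi r
          have := hi (r + 1)
          have := hj r
          have := hj (r + 1)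
          simp only [bwd]; split_ifs at * <;> omega
        | succ i =>
          right
          refine ⟨i, fun r => ?_⟩
          have := key r
          have := hi r
          have := hi (r + 1)
          have := hj r
          have := hj (r + 1)
          simp only [bwd]; split_ifs at * <;> omega
      · right
        refine ⟨j, fun r => ?_⟩
        have := hi r
        have := hi (r + 1)
        have := hj r
        have := hj (r + 1)
        simp only [bwd]; split_ifs at * <;> omega

theorem bwd_antitone {m v p : ℕ → ℕ} (hm : Adj m p) (hv : Adj v p) (am : Antitone m)
    (av : Antitone v) (ap : Antitone p) : Antitone (bwd m v p) := by
  refine antitone_nat_of_succ_le fun r => ?_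
  have h1 := hm.interlace am ap r
  have h2 := hv.interlace av ap r
  have h3 := am (Nat.le_succ r)
  have h4 := av (Nat.le_succ r)
  have h5 := hm.le (r + 1)
  have h6 := hv.le (r + 1)
  have h7 := hm.le_succ (r + 1)
  have h8 := hv.le_succ (r + 1)
  simp only [bwd, Nat.succ_eq_add_one] at *
  omega

/-- The first row of `p` exceeds both others only if `m` and `v` lack the same box of row `0`. No
row lies above from which it could be bumped, so it records an entry. -/
theorem eq_bwd_of_lt {m v p : ℕ → ℕ} (hm : Adj m p) (hv : Adj v p)
    (h : max (m 0) (v 0) < p 0) : bwd m v p = m ∧ bwd m v p = v ∧ p 0 - max (m 0) (v 0) = 1 := by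
  rcases hm with rfl | ⟨i, hi⟩
  · omega
  rcases hv with rfl | ⟨j, hj⟩
  · omega
  have h1 := hi 0
  have h2 := hj 0
  obtain rfl : i = 0 := by by_contra; rw [if_neg (by omega)] at h1; omega
  obtain rfl : j = 0 := by by_contra; rw [if_neg (by omega)] at h2; omega
  have h3 : m = v := by
    funext r
    have := hi r
    have := hj r
    omega
  subst h3
  have h4 : bwd m m p = m := by
    funext r
    have := hi (r + 1)
    simp only [bwd]; split_ifs at * <;> omega
  refine ⟨h4, h4, ?_⟩
  simp at h1
  omega

/-! ### Growth diagrams of partial permutations -/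

/-- A filling of the quarter plane with at most one entry in each row and column. -/
structure IsPartialPerm (S : ℕ → ℕ → Prop) : Prop where
  row : ∀ {x y y'}, S x y → S x y' → y = y'
  col : ∀ {x x' y}, S x y → S x' y → x = x'

open Classical in
/-- The growth diagram of a filling: `grow S x y` is the sequence of row lengths of the partition
attached to the rectangle `[0, x) × [0, y)`. -/
noncomputable def grow (S : ℕ → ℕ → Prop) : ℕ → ℕ → ℕ → ℕ
  | 0, _ => 0
  | _ + 1, 0 => 0
  | x + 1, y + 1 =>
    fwd (grow S x y) (grow S (x + 1) y) (grow S x (y + 1)) (if S x y then 1 else 0)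

variable {S : ℕ → ℕ → Prop}

@[simp] theorem grow_zero_left (y : ℕ) : grow S 0 y = 0 := by rw [grow]

@[simp] theorem grow_zero_right (x : ℕ) : grow S x 0 = 0 := by cases x <;> rw [grow]

open Classical in
theorem grow_succ_succ (x y : ℕ) : grow S (x + 1) (y + 1) =
    fwd (grow S x y) (grow S (x + 1) y) (grow S x (y + 1)) (if S x y then 1 else 0) := by
  rw [grow]

theorem antitone_zero : Antitone (0 : ℕ → ℕ) := fun _ _ _ => le_rfl

open Classical in
theorem grow_congr {S T : ℕ → ℕ → Prop} {x y : ℕ} (h : ∀ a b, a < x → b < y → (S a b ↔ T a b)) :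
    grow S x y = grow T x y := by
  induction x generalizing y with
  | zero => simp
  | succ x ihx =>
    induction y with
    | zero => simp
    | succ y ihy =>
      rw [grow_succ_succ, grow_succ_succ, ihy fun a b ha hb => h a b ha (by omega),
        ihx fun a b ha hb => h a b (by omega) hb,
        ihx fun a b ha hb => h a b (by omega) (by omega)]
      congr 1
      exact if_congr (h x y (by omega) (by omega)) rfl rfl

/-- The invariants of the growth diagram at the corner `(x, y)`. -/
structure GrowInv (S : ℕ → ℕ → Prop) (x y : ℕ) : Prop where
  antitone : Antitone (grow S x y)
  adj_left : Adj (grow S x y) (grow S (x + 1) y)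
  adj_right : Adj (grow S x y) (grow S x (y + 1))
  eq_left : grow S x y = grow S (x + 1) y ↔ ∀ b < y, ¬ S x b
  eq_right : grow S x y = grow S x (y + 1) ↔ ∀ a < x, ¬ S a y

-- This carries the edge conditions across one cell. If the cell has an entry, the earlier cells of
-- its row and column are empty, so `eq_left` and `eq_right` make the three known corners equal, as
-- `adj_fwd` requires.
open Classical in
theorem growInv_aux (hS : IsPartialPerm S) {x y : ℕ} (h : GrowInv S x y) :
    Adj (grow S x (y + 1)) (grow S (x + 1) (y + 1)) ∧
    Adj (grow S (x + 1) y) (grow S (x + 1) (y + 1)) ∧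
    (grow S x (y + 1) = grow S (x + 1) (y + 1) ↔ ∀ b < y + 1, ¬ S x b) ∧
    (grow S (x + 1) y = grow S (x + 1) (y + 1) ↔ ∀ a < x + 1, ¬ S a y) := by
  have hc : (if S x y then 1 else 0) = 1 →
      grow S (x + 1) y = grow S x y ∧ grow S x (y + 1) = grow S x y := by
    intro hc
    have hxy : S x y := by by_contra hn; simp [hn] at hc
    exact ⟨(h.eq_left.2 fun b hb hn => by have := hS.row hxy hn; omega).symm,
      (h.eq_right.2 fun a ha hn => by have := hS.col hxy hn; omega).symm⟩
  have hle : (if S x y then 1 else 0) ≤ 1 := by split_ifs <;> simp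
  rw [grow_succ_succ]
  refine ⟨adj_fwd h.adj_left h.adj_right hle hc, ?_, ⟨fun he => ?_, fun he => ?_⟩,
    ⟨fun he => ?_, fun he => ?_⟩⟩
  · rw [fwd_comm]
    exact adj_fwd h.adj_right h.adj_left hle fun e => (hc e).symm
  · obtain ⟨h1, h2⟩ := eq_of_fwd_eq h.adj_left h.adj_right he
    intro b hb
    obtain rfl | hb : b = y ∨ b < y := by omega
    · intro hn; simp [hn] at h2
    · exact h.eq_left.1 h1.symm b hb
  · have h1 := h.eq_left.2 fun b hb => he b (by omega)
    rw [if_neg (he y (by omega)), ← h1]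
    funext r
    have := h.adj_right.le r
    cases r with
    | zero => simp only [fwd]; omega
    | succ r => have := h.adj_right.le r; simp only [fwd]; omega
  · rw [fwd_comm] at he
    obtain ⟨h1, h2⟩ := eq_of_fwd_eq h.adj_right h.adj_left he
    intro a ha
    obtain rfl | ha : a = x ∨ a < x := by omega
    · intro hn; simp [hn] at h2
    · exact h.eq_right.1 h1.symm a ha
  · have h1 := h.eq_right.2 fun a ha => he a (by omega)
    rw [if_neg (he x (by omega)), ← h1]
    funext r
    have := h.adj_left.le r
    cases r with
    | zero => simp only [fwd]; omega
    | succ r => have := h.adj_left.le r; simp only [fwd]; omega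

theorem growInv (hS : IsPartialPerm S) (x y : ℕ) : GrowInv S x y := by
  induction x generalizing y with
  | zero =>
    have h : ∀ y, Adj (grow S 0 y) (grow S 1 y) ∧ (grow S 0 y = grow S 1 y ↔ ∀ b < y, ¬ S 0 b) := by
      intro y
      induction y with
      | zero => simp [Adj]
      | succ y ih =>
        have := growInv_aux hS (x := 0) (y := y)
          ⟨by simpa using antitone_zero, ih.1, by simp [Adj], ih.2, by simp⟩
        exact ⟨this.1, this.2.2.1⟩
    exact ⟨by simpa using antitone_zero, (h y).1, by simp [Adj], (h y).2, by simp⟩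
  | succ x ihx =>
    induction y with
    | zero =>
      have := growInv_aux hS (ihx 0)
      exact ⟨by simpa using antitone_zero, by simp [Adj], this.2.1, by simp, this.2.2.2⟩
    | succ y ihy =>
      -- The two edges leaving the corner are far edges of the two neighbouring cells.
      have h1 := growInv_aux hS (ihx (y + 1))
      have h2 := growInv_aux hS ihy
      refine ⟨?_, h2.1, h1.2.1, h2.2.2.1, h1.2.2.2⟩
      rw [grow_succ_succ]
      exact fwd_antitone (ihx y).adj_left (ihx y).adj_right (ihx y).antitone ihy.antitone
        (ihx (y + 1)).antitone

theorem grow_eq_zero {x y r : ℕ} (h : x ≤ r) : grow S x y r = 0 := by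
  induction x generalizing y r with
  | zero => simp
  | succ x ihx =>
    induction y with
    | zero => simp
    | succ y ihy =>
      obtain ⟨r, rfl⟩ : ∃ s, r = s + 1 := ⟨r - 1, by omega⟩
      rw [grow_succ_succ, fwd, ihy, ihx (by omega), ihx (by omega)]
      simp

theorem bwd_grow (hS : IsPartialPerm S) (x y : ℕ) :
    bwd (grow S (x + 1) y) (grow S x (y + 1)) (grow S (x + 1) (y + 1)) = grow S x y := by
  rw [grow_succ_succ]
  exact bwd_fwd (growInv hS x y).adj_left.le (growInv hS x y).adj_right.le

theorem iff_grow (S : ℕ → ℕ → Prop) (x y : ℕ) :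
    S x y ↔ max (grow S (x + 1) y 0) (grow S x (y + 1) 0) < grow S (x + 1) (y + 1) 0 := by
  rw [grow_succ_succ, fwd]
  split_ifs with h <;> simp [h]

/-- A filling of a staircase is determined by the partitions on its border. -/
theorem grow_injective {S T : ℕ → ℕ → Prop} (hS : IsPartialPerm S) (hT : IsPartialPerm T) {d : ℕ}
    (h : ∀ x y, x + y = d ∨ x + y = d + 1 → grow S x y = grow T x y) {x y : ℕ} (hxy : x + y < d) :
    S x y ↔ T x y := by
  induction d with
  | zero => omega
  | succ d ih =>
    obtain hd | hd : x + y < d ∨ x + y = d := by omega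
    · refine ih (fun x y hxy => ?_) hd
      rcases hxy with e | e
      · rw [← bwd_grow hS, ← bwd_grow hT, h _ _ (by omega), h x (y + 1) (by omega),
          h _ _ (by omega)]
      · exact h _ _ (by omega)
    · rw [iff_grow S, iff_grow T, h _ _ (by omega), h x (y + 1) (by omega), h _ _ (by omega)]

/-- Every admissible labelling of the border of a staircase comes from a filling. -/
theorem exists_grow_eq (d : ℕ) (M : ℕ → ℕ → ℕ → ℕ)
    (ha : ∀ x y, x + y = d ∨ x + y = d + 1 → Antitone (M x y))
    (h0 : ∀ y, y = d ∨ y = d + 1 → M 0 y = 0 ∧ M y 0 = 0)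
    (hl : ∀ x y, x + y = d → Adj (M x y) (M (x + 1) y))
    (hr : ∀ x y, x + y = d → Adj (M x y) (M x (y + 1))) :
    ∃ S, IsPartialPerm S ∧ (∀ x y, S x y → x + y < d) ∧
      ∀ x y, x + y = d ∨ x + y = d + 1 → grow S x y = M x y := by
  induction d generalizing M with
  | zero =>
    refine ⟨fun _ _ => False, ⟨by simp, by simp⟩, by simp, fun x y h => ?_⟩
    -- The diagonals `0` and `1` lie on the axes.
    obtain rfl | rfl : x = 0 ∨ y = 0 := by omega
    · rw [(h0 y (by omega)).1]; simp
    · rw [(h0 x (by omega)).2]; simp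
  | succ d ih =>
    -- The backward rule extends the labelling inwards to diagonal `d`; induction then fills the
    -- smaller staircase.
    let M' : ℕ → ℕ → ℕ → ℕ := fun x y =>
      if x + y = d then bwd (M (x + 1) y) (M x (y + 1)) (M (x + 1) (y + 1)) else M x y
    have hM : ∀ {x y}, x + y = d →
        M' x y = bwd (M (x + 1) y) (M x (y + 1)) (M (x + 1) (y + 1)) := fun h => if_pos h
    have hM1 : ∀ {x y}, x + y ≠ d → M' x y = M x y := fun h => if_neg h
    have hadj : ∀ {x y}, x + y = d → Adj (M' x y) (M (x + 1) y) ∧ Adj (M' x y) (M x (y + 1)) := by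
      intro x y h
      rw [hM h]
      refine ⟨?_, ?_⟩
      · exact adj_bwd (hr _ _ (by omega)) (hl _ _ (by omega)) (ha _ _ (by omega))
          (ha _ _ (by omega))
      · rw [bwd_comm]
        exact adj_bwd (hl _ _ (by omega)) (hr _ _ (by omega)) (ha _ _ (by omega))
          (ha _ _ (by omega))
    have hzero : ∀ {f : ℕ → ℕ}, Adj f 0 → f = 0 := by
      intro f h
      funext r
      simpa using h.le r
    obtain ⟨S, hS, hsup, hg⟩ := ih M'
      (by
        intro x y h
        rcases h with h | h
        · rw [hM h]
          exact bwd_antitone (hr _ _ (by omega)) (hl _ _ (by omega)) (ha _ _ (by omega))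
            (ha _ _ (by omega)) (ha _ _ (by omega))
        · rw [hM1 (by omega)]
          exact ha _ _ (by omega))
      (by
        intro y h
        rcases h with rfl | rfl
        · constructor
          · have := (hadj (x := 0) (y := y) (by omega)).2
            rw [(h0 (y + 1) (by omega)).1] at this
            exact hzero this
          · have := (hadj (x := y) (y := 0) (by omega)).1
            rw [(h0 (y + 1) (by omega)).2] at this
            exact hzero this
        · rw [hM1 (by omega), hM1 (by omega)]
          exact h0 _ (by omega))
      (by
        intro x y h
        rw [hM1 (x := x + 1) (by omega)]
        exact (hadj h).1)
      (by
        intro x y h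
        rw [hM1 (x := x) (y := y + 1) (by omega)]
        exact (hadj h).2)
    let N : ℕ → ℕ → Prop := fun x y =>
      x + y = d ∧ max (M (x + 1) y 0) (M x (y + 1) 0) < M (x + 1) (y + 1) 0
    -- At a new entry the three nearer labels agree, and trivial edges mean that `S` has no earlier
    -- entry in that row or column.
    have hN : ∀ {x y}, N x y → (∀ b < y, ¬ S x b) ∧ (∀ a < x, ¬ S a y) := by
      intro x y h
      have he := eq_bwd_of_lt (hr (x + 1) y (by have := h.1; omega))
        (hl x (y + 1) (by have := h.1; omega)) h.2
      rw [← hM h.1, ← hg x y (Or.inl h.1), ← hM1 (x := x + 1) (y := y) (by have := h.1; omega),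
        ← hM1 (x := x) (y := y + 1) (by have := h.1; omega),
        ← hg (x + 1) y (by have := h.1; omega), ← hg x (y + 1) (by have := h.1; omega)] at he
      exact ⟨(growInv hS x y).eq_left.1 he.1, (growInv hS x y).eq_right.1 he.2.1⟩
    refine ⟨fun x y => S x y ∨ N x y, ⟨?_, ?_⟩, ?_, ?_⟩
    · rintro x y y' (h | h) (h' | h')
      · exact hS.row h h'
      · exact absurd h ((hN h').1 y (by have := hsup _ _ h; have := h'.1; omega))
      · exact absurd h' ((hN h).1 y' (by have := hsup _ _ h'; have := h.1; omega))
      · have := h.1; have := h'.1; omega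
    · rintro x x' y (h | h) (h' | h')
      · exact hS.col h h'
      · exact absurd h ((hN h').2 x (by have := hsup _ _ h; have := h'.1; omega))
      · exact absurd h' ((hN h).2 x' (by have := hsup _ _ h'; have := h.1; omega))
      · have := h.1; have := h'.1; omega
    · rintro x y (h | h)
      · have := hsup _ _ h; omega
      · have := h.1; omega
    -- Rectangles with corner up to diagonal `d + 1` do not reach the new cells, which lie on
    -- diagonal `d`.
    · have hlow : ∀ x y, x + y ≤ d + 1 → grow (fun x y => S x y ∨ N x y) x y = grow S x y := by
        intro x y h
        refine grow_congr fun a b h1 h2 => ⟨fun hab => hab.resolve_right fun hn => ?_, Or.inl⟩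
        have := hn.1; omega
      have hlow' : ∀ x y, x + y = d + 1 → grow (fun x y => S x y ∨ N x y) x y = M x y := by
        intro x y h
        rw [hlow x y h.le, hg x y (Or.inr h), hM1 (by omega)]
      rintro x y (h | h)
      · exact hlow' x y h
      · match x, y, h with
        | 0, y, h => rw [grow_zero_left, (h0 y (by omega)).1]
        | x + 1, 0, h => rw [grow_zero_right, (h0 (x + 1) (by omega)).2]
        | x + 1, y + 1, h =>
          have hS' : ¬ S x y := fun hs => by have := hsup _ _ hs; omega
          have hd : x + y = d := by omega
          rw [grow_succ_succ, hlow' (x + 1) y (by omega), hlow' x (y + 1) (by omega), hlow x y (by omega),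
            hg x y (by omega), hM hd]
          have h1 := hr (x + 1) y (by omega)
          have h2 := hl x (y + 1) (by omega)
          refine Eq.trans ?_ (fwd_bwd h1 h2
            (ha _ _ (by omega)) (ha _ _ (by omega)) (ha _ _ (by omega)))
          congr 1
          by_cases hlt : max (M (x + 1) y 0) (M x (y + 1) 0) < M (x + 1) (y + 1) 0
          · rw [if_pos (Or.inr ⟨hd, hlt⟩), (eq_bwd_of_lt h1 h2 hlt).2.2]
          · rw [if_neg (fun hn => hn.elim hS' fun hn => hlt hn.2)]
            omega

/-! ### Chains in fillings -/

/-- The filling has `k` entries in `[0, x) × [0, y)` with increasing rows and columns. -/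
def Inc (S : ℕ → ℕ → Prop) : ℕ → ℕ → ℕ → Prop
  | 0, _, _ => True
  | k + 1, x, y => ∃ a b, a < x ∧ b < y ∧ S a b ∧ Inc S k a b

/-- The filling has `k` entries in `[l, X) × [0, y)` with increasing rows and decreasing columns. -/
def Dec (S : ℕ → ℕ → Prop) (X : ℕ) : ℕ → ℕ → ℕ → Prop
  | 0, _, _ => True
  | k + 1, l, y => ∃ a b, l ≤ a ∧ a < X ∧ b < y ∧ S a b ∧ Dec S X k (a + 1) b

theorem Inc.mono {k x y x' y' : ℕ} (h : Inc S k x y) (hx : x ≤ x') (hy : y ≤ y') :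
    Inc S k x' y' := by
  cases k with
  | zero => trivial
  | succ k =>
    obtain ⟨a, b, h1, h2, h3⟩ := h
    exact ⟨a, b, h1.trans_le hx, h2.trans_le hy, h3⟩

theorem Dec.mono {X k l y l' y' : ℕ} (h : Dec S X k l y) (hl : l' ≤ l) (hy : y ≤ y') :
    Dec S X k l' y' := by
  cases k with
  | zero => trivial
  | succ k =>
    obtain ⟨a, b, h0, h1, h2, h3⟩ := h
    exact ⟨a, b, hl.trans h0, h1, h2.trans_le hy, h3⟩

/-- A function on the corners that grows by the local rule of the first row of a growth diagram. -/
structure IsLayer (S : ℕ → ℕ → Prop) (L : ℕ → ℕ → ℕ) : Prop where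
  perm : IsPartialPerm S
  zero_left : ∀ y, L 0 y = 0
  zero_right : ∀ x, L x 0 = 0
  le_left : ∀ x y, L x y ≤ L (x + 1) y
  le_right : ∀ x y, L x y ≤ L x (y + 1)
  left_le : ∀ x y, L (x + 1) y ≤ L x y + 1
  right_le : ∀ x y, L x (y + 1) ≤ L x y + 1
  entry : ∀ {x y}, S x y →
    L (x + 1) y = L x y ∧ L x (y + 1) = L x y ∧ L (x + 1) (y + 1) = L x y + 1
  no_entry : ∀ {x y}, ¬ S x y → L (x + 1) (y + 1) = max (L (x + 1) y) (L x (y + 1))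

/-- The cells at which both incoming edges are increments of `L`. -/
def skeleton (L : ℕ → ℕ → ℕ) (x y : ℕ) : Prop :=
  L x y < L (x + 1) y ∧ L x y < L x (y + 1)

namespace IsLayer

variable {L : ℕ → ℕ → ℕ}

theorem swap (h : IsLayer S L) : IsLayer (fun x y => S y x) fun x y => L y x where
  perm := ⟨h.perm.col, h.perm.row⟩
  zero_left := h.zero_right
  zero_right := h.zero_left
  le_left x y := h.le_right y x
  le_right x y := h.le_left y x
  left_le x y := h.right_le y x
  right_le x y := h.left_le y x
  entry hs := ⟨(h.entry hs).2.1, (h.entry hs).1, (h.entry hs).2.2⟩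
  no_entry hs := by rw [h.no_entry hs, max_comm]

theorem mono (h : IsLayer S L) {x y x' y' : ℕ} (hx : x ≤ x') (hy : y ≤ y') : L x y ≤ L x' y' :=
  (monotone_nat_of_le_succ (f := fun x => L x y) (fun x => h.le_left x y) hx).trans
  (monotone_nat_of_le_succ (f := fun y => L x' y) (fun y => h.le_right x' y) hy)

/-- An entry extends every chain strictly below it; at an empty cell a longest chain already lies in
one of the two smaller rectangles. -/
theorem le_iff_inc (h : IsLayer S L) {k x y : ℕ} : k ≤ L x y ↔ Inc S k x y := by
  constructor
  · intro hk
    induction x generalizing k y with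
    | zero =>
      obtain rfl : k = 0 := by rw [h.zero_left] at hk; omega
      trivial
    | succ x ihx =>
      induction y with
      | zero =>
        obtain rfl : k = 0 := by rw [h.zero_right] at hk; omega
        trivial
      | succ y ihy =>
        by_cases hs : S x y
        · cases k with
          | zero => trivial
          | succ k =>
            rw [(h.entry hs).2.2] at hk
            exact ⟨x, y, by omega, by omega, hs, ihx (by omega)⟩
        · rw [h.no_entry hs, le_max_iff] at hk
          rcases hk with hk | hk
          · exact (ihy hk).mono le_rfl (by omega)
          · exact (ihx hk).mono (by omega) le_rfl
  · intro hk
    induction k generalizing x y with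
    | zero => omega
    | succ k ih =>
      obtain ⟨a, b, h1, h2, h3, h4⟩ := hk
      have := ih h4
      have := (h.entry h3).2.2
      have := h.mono (show a + 1 ≤ x by omega) (show b + 1 ≤ y by omega)
      omega

/-- An edge becomes an increment only at an entry of its strip. -/
theorem exists_entry (h : IsLayer S L) {t t' v : ℕ} (ht : t ≤ t') (h1 : L t (v + 1) = L t v)
    (h2 : L t' v < L t' (v + 1)) : ∃ u, t ≤ u ∧ u < t' ∧ S u v := by
  induction t', ht using Nat.le_induction with
  | base => omega
  | succ t' ht ih =>
    by_cases hlt : L t' v < L t' (v + 1)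
    · obtain ⟨u, hu, hu', hs⟩ := ih hlt
      exact ⟨u, hu, by omega, hs⟩
    · by_cases hs : S t' v
      · exact ⟨t', ht, by omega, hs⟩
      · have := h.no_entry hs
        have := h.le_left t' v
        omega

theorem exists_entry_left (h : IsLayer S L) {t v : ℕ} (h2 : L t v < L t (v + 1)) :
    ∃ u < t, S u v := by
  obtain ⟨u, -, hu⟩ := h.exists_entry (Nat.zero_le t) (by simp [h.zero_left]) h2
  exact ⟨u, hu⟩

/-- An increment persists up to the next skeleton cell in its strip. -/
theorem exists_skeleton (h : IsLayer S L) {t t' v : ℕ} (ht : t ≤ t') (h1 : L t v < L t (v + 1))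
    (hs : ∀ u, t ≤ u → u < t' → ¬ skeleton L u v) : L t' v < L t' (v + 1) := by
  induction t', ht using Nat.le_induction with
  | base => exact h1
  | succ t' ht ih =>
    have h3 := ih fun u hu hu' => hs u hu (by omega)
    have h4 := hs t' ht (by omega)
    have h5 : L (t' + 1) v = L t' v :=
      le_antisymm (by_contra fun hn => h4 ⟨by omega, h3⟩) (h.le_left _ _)
    have := h.le_left t' (v + 1)
    omega

theorem not_entry_of_skeleton (h : IsLayer S L) {x y : ℕ} (hs : skeleton L x y) : ¬ S x y :=
  fun hn => by
    have := h.entry hn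
    have := hs.1
    omega

theorem edge_of_skeleton (h : IsLayer S L) {x y : ℕ} (hs : skeleton L x y) :
    L (x + 1) (y + 1) = L (x + 1) y ∧ L (x + 1) (y + 1) = L x (y + 1) := by
  have := h.no_entry (h.not_entry_of_skeleton hs)
  have := hs.1
  have := hs.2
  have := h.left_le x y
  have := h.right_le x y
  omega

/-- The increments created by the two entries run along their strips towards the cell `(c, b)`. If
no skeleton cell stops them earlier, both arrive and make `(c, b)` one. -/
theorem skeleton_between_entries (h : IsLayer S L) {a b c d : ℕ} (h1 : S a b) (h2 : S c d)
    (hac : a < c) (hdb : d < b) : ∃ t z, a < t ∧ t ≤ c ∧ d < z ∧ z ≤ b ∧ skeleton L t z := by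
  by_contra! hn
  have e1 := h.exists_skeleton (t := a + 1) (t' := c) (v := b) hac
    (by have := h.entry h1; omega) fun u hu hu' => hn u b hu hu'.le hdb le_rfl
  have e2 := h.swap.exists_skeleton (t := d + 1) (t' := b) (v := c) hdb
    (by have := h.entry h2; omega) fun u hu hu' hs => hn c u hac le_rfl hu hu'.le ⟨hs.2, hs.1⟩
  exact hn c b hac le_rfl hdb le_rfl ⟨e2, e1⟩

/-- The edges at `(t, b')` decide. A trivial edge there must become an increment before reaching the
given skeleton cell in its strip, which takes an entry. If both are increments, `(t, b')` is itself
a skeleton cell and its far edges are trivial. -/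
theorem entry_between_skeletons (h : IsLayer S L) {t b t' b' : ℕ} (h1 : skeleton L t b)
    (h2 : skeleton L t' b') (ht : t < t') (hb : b' < b) :
    ∃ u v, t ≤ u ∧ u < t' ∧ b' ≤ v ∧ v < b ∧ S u v := by
  by_cases e1 : L t b' < L t (b' + 1)
  · by_cases e2 : L t b' < L (t + 1) b'
    · obtain ⟨u, hu, hu', hs⟩ := h.exists_entry (t := t + 1) (t' := t') ht
        (h.edge_of_skeleton ⟨e2, e1⟩).1 h2.2
      exact ⟨u, b', by omega, hu', le_rfl, hb, hs⟩
    · obtain ⟨v, hv, hv', hs⟩ := h.swap.exists_entry hb.le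
        (le_antisymm (not_lt.1 e2) (h.le_left _ _)) h1.1
      exact ⟨t, v, le_rfl, ht, hv, hv', hs⟩
  · obtain ⟨u, hu, hu', hs⟩ := h.exists_entry ht.le
      (le_antisymm (not_lt.1 e1) (h.le_right _ _)) h2.2
    exact ⟨u, b', hu, hu', le_rfl, hb, hs⟩

/-- A skeleton cell ends the increment of its strip. A second one would need a second entry to
restart it. -/
theorem isPartialPerm_skeleton_aux (h : IsLayer S L) {t t' b : ℕ} (h1 : skeleton L t b)
    (h2 : skeleton L t' b) : t' ≤ t := by
  by_contra! ht
  obtain ⟨u, hu, hu', hs⟩ := h.exists_entry (t := t + 1) (t' := t') ht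
    (h.edge_of_skeleton h1).1 h2.2
  obtain ⟨w, hw, hs'⟩ := h.exists_entry_left h1.2
  have := h.perm.col hs hs'
  omega

theorem isPartialPerm_skeleton (h : IsLayer S L) : IsPartialPerm (skeleton L) where
  col h1 h2 := le_antisymm (h.isPartialPerm_skeleton_aux h2 h1) (h.isPartialPerm_skeleton_aux h1 h2)
  row h1 h2 := le_antisymm (h.swap.isPartialPerm_skeleton_aux ⟨h2.2, h2.1⟩ ⟨h1.2, h1.1⟩)
    (h.swap.isPartialPerm_skeleton_aux ⟨h1.2, h1.1⟩ ⟨h2.2, h2.1⟩)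

theorem dec_skeleton_of_dec (h : IsLayer S L) {X r a b : ℕ} (hs : S a b)
    (hd : Dec S X r (a + 1) b) : Dec (skeleton L) X r (a + 1) (b + 1) := by
  induction r generalizing a b with
  | zero => trivial
  | succ r ih =>
    obtain ⟨c, d, h1, h2, h3, h4, h5⟩ := hd
    obtain ⟨t, z, e1, e2, e3, e4, e5⟩ := h.skeleton_between_entries hs h4 h1 h3
    exact ⟨t, z, e1, by omega, by omega, e5, (ih h4 h5).mono (by omega) (by omega)⟩

/-- Entries interlace with the skeleton chain, and the last skeleton cell `(t, b)` contributes one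
more: its increment in strip `t` comes from an entry `(t, v)` with `v < b`. -/
theorem dec_of_dec_skeleton (h : IsLayer S L) {X r t b : ℕ} (hs : skeleton L t b) (ht : t < X)
    (hd : Dec (skeleton L) X r (t + 1) b) : Dec S X (r + 1) t b := by
  induction r generalizing t b with
  | zero =>
    obtain ⟨v, hv, hs'⟩ := h.swap.exists_entry_left hs.1
    exact ⟨t, v, le_rfl, ht, hv, hs', trivial⟩
  | succ r ih =>
    obtain ⟨t', b', h1, h2, h3, h4, h5⟩ := hd
    obtain ⟨u, v, e1, e2, e3, e4, e5⟩ := h.entry_between_skeletons hs h4 h1 h3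
    exact ⟨u, v, e1, by omega, e4, e5, (ih h4 h2 h5).mono (by omega) e3⟩

/-- The longest decreasing chain of the skeleton is shorter by one than that of the filling. -/
theorem dec_iff (h : IsLayer S L) {X Y r : ℕ} :
    Dec S X (r + 2) 0 Y ↔ Dec (skeleton L) X (r + 1) 0 Y := by
  constructor
  · rintro ⟨a, b, -, -, hb, hs, hd⟩
    exact (h.dec_skeleton_of_dec hs hd).mono (by omega) hb
  · rintro ⟨t, b, -, ht, hb, hs, hd⟩
    -- The extra entry at the other end, in the strip `b` of the first skeleton cell.
    obtain ⟨u, hu, hs'⟩ := h.exists_entry_left hs.2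
    exact ⟨u, b, by omega, by omega, hb, hs', (h.dec_of_dec_skeleton hs ht hd).mono hu le_rfl⟩

end IsLayer

/-- The fillings whose first rows are the successive rows of a growth diagram. -/
def layerFilling (S : ℕ → ℕ → Prop) : ℕ → ℕ → ℕ → Prop
  | 0 => S
  | r + 1 => skeleton fun x y => grow S x y r

/-- Row `r + 1` receives a bumped box exactly where both near edges enlarge row `r`, that is, at the
skeleton cells of row `r`. These act as its entries. -/
theorem isLayer_grow (hS : IsPartialPerm S) (r : ℕ) :
    IsLayer (layerFilling S r) fun x y => grow S x y r := by
  induction r with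
  | zero =>
    refine ⟨hS, by simp, by simp, fun x y => (growInv hS x y).adj_left.le 0,
      fun x y => (growInv hS x y).adj_right.le 0, fun x y => (growInv hS x y).adj_left.le_succ 0,
      fun x y => (growInv hS x y).adj_right.le_succ 0, fun {x y} h => ?_, fun {x y} h => ?_⟩
    · have h : S x y := h
      have h1 := (growInv hS x y).eq_left.2 fun b hb hn => by have := hS.row h hn; omega
      have h2 := (growInv hS x y).eq_right.2 fun a ha hn => by have := hS.col h hn; omega
      simp [grow_succ_succ, fwd, h, ← h1, ← h2]
    · have h : ¬ S x y := h
      simp [grow_succ_succ, fwd, h]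
  | succ r ih =>
    refine ⟨ih.isPartialPerm_skeleton, by simp, by simp,
      fun x y => (growInv hS x y).adj_left.le _,
      fun x y => (growInv hS x y).adj_right.le _, fun x y => (growInv hS x y).adj_left.le_succ _,
      fun x y => (growInv hS x y).adj_right.le_succ _, fun {x y} h => ?_, fun {x y} h => ?_⟩
    · have h1 : grow S x y r < grow S (x + 1) y r := h.1
      have h2 : grow S x y r < grow S x (y + 1) r := h.2
      have e1 := ih.left_le x y
      have e2 := ih.right_le x y
      have key : ∀ {f g : ℕ → ℕ}, Adj f g → f r < g r → g (r + 1) = f (r + 1) := by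
        rintro f g (rfl | ⟨p, hp⟩) hlt
        · rfl
        · have := hp r
          have := hp (r + 1)
          split_ifs at * <;> omega
      have k1 := key (growInv hS x y).adj_left h1
      have k2 := key (growInv hS x y).adj_right h2
      refine ⟨k1, k2, ?_⟩
      rw [grow_succ_succ]
      simp only [fwd]
      omega
    · have h : ¬ (grow S x y r < grow S (x + 1) y r ∧ grow S x y r < grow S x (y + 1) r) := h
      simp only [grow_succ_succ, fwd]
      omega

theorem le_grow_zero_iff (hS : IsPartialPerm S) {x y k : ℕ} : k ≤ grow S x y 0 ↔ Inc S k x y :=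
  (isLayer_grow hS 0).le_iff_inc

/-- Each passage to the skeleton shortens decreasing chains by one, so after `r` passages a chain of
length `r + 1` has become a single entry of layer `r`. -/
theorem grow_pos_iff (hS : IsPartialPerm S) {x y r : ℕ} :
    0 < grow S x y r ↔ Dec S x (r + 1) 0 y := by
  have h : ∀ s k, Dec (layerFilling S s) x (k + 1) 0 y ↔ Dec S x (s + k + 1) 0 y := by
    intro s
    induction s with
    | zero => intro k; rw [Nat.zero_add]; rfl
    | succ s ih =>
      intro k
      rw [show s + 1 + k + 1 = s + (k + 1) + 1 by omega, ← ih (k + 1)]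
      exact (isLayer_grow hS s).dec_iff.symm
  rw [← Nat.succ_le_iff, Nat.succ_eq_add_one]
  refine ((isLayer_grow hS r).le_iff_inc (k := 0 + 1)).trans (Iff.trans ?_ (h r 0))
  constructor
  · rintro ⟨a, b, h1, h2, h3, -⟩
    exact ⟨a, b, by omega, h1, h2, h3, trivial⟩
  · rintro ⟨a, b, -, h1, h2, h3, -⟩
    exact ⟨a, b, h1, h2, h3, trivial⟩

/-! ### Conjugate partitions -/

/-- The conjugate of a partition. -/
noncomputable def conj (f : ℕ → ℕ) (c : ℕ) : ℕ := sInf {r | f r ≤ c}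

/-- Both sides say that the box in row `r` and column `c` belongs to the diagram. The zero at `N`
ensures that the infimum is attained and is not the default value on the empty set. -/
theorem lt_conj_iff {f : ℕ → ℕ} (hf : Antitone f) {N : ℕ} (h0 : f N = 0) {r c : ℕ} :
    r < conj f c ↔ c < f r := by
  have hne : {r | f r ≤ c}.Nonempty := ⟨N, by simp [h0]⟩
  constructor
  · intro h
    by_contra hn
    exact Nat.notMem_of_lt_sInf h (not_lt.1 hn)
  · intro h
    by_contra hn
    have h1 : f (conj f c) ≤ c := Nat.sInf_mem hne
    have := hf (not_lt.1 hn)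
    omega

theorem conj_antitone {f : ℕ → ℕ} (hf : Antitone f) {N : ℕ} (h0 : f N = 0) :
    Antitone (conj f) := by
  intro c d hcd
  refine le_of_not_gt fun h => ?_
  have h1 := (lt_conj_iff hf h0).1 h
  exact lt_irrefl _ ((lt_conj_iff hf h0).2 (hcd.trans_lt h1))

theorem conj_zero : conj 0 = 0 := by
  funext c
  simp [conj]

theorem conj_injective {f g : ℕ → ℕ} (hf : Antitone f) (hg : Antitone g) {N M : ℕ}
    (hN : f N = 0) (hM : g M = 0) (h : conj f = conj g) : f = g := by
  funext r
  refine eq_of_forall_lt_iff fun c => ?_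
  rw [← lt_conj_iff hf hN, ← lt_conj_iff hg hM, h]

theorem Adj.conj {f g : ℕ → ℕ} (h : Adj f g) (hf : Antitone f) (hg : Antitone g) {N : ℕ}
    (hN : g N = 0) : Adj (conj f) (conj g) := by
  have hM : f N = 0 := by have := h.le N; omega
  rcases h with rfl | ⟨p, hp⟩
  · exact Or.inl rfl
  -- The box added to row `p` lies in column `f p`.
  · refine Or.inr ⟨f p, fun c => eq_of_forall_lt_iff fun r => ?_⟩
    rw [lt_conj_iff hg hN, hp r]
    have h1 : ∀ r, r < SetPartition.conj f c ↔ c < f r := fun r => lt_conj_iff hf hM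
    by_cases hc : c = f p
    · subst hc
      -- Rows above `p` are longer than `f p`, because `g` is still a partition.
      have h2 : SetPartition.conj f (f p) = p := by
        refine eq_of_forall_lt_iff fun r => ?_
        rw [h1]
        constructor
        · intro h
          by_contra hn
          have := hf (not_lt.1 hn)
          omega
        · intro h
          have := hg h.le
          have e1 := hp r
          have e2 := hp p
          split_ifs at e1 e2 <;> omega
      rw [if_pos rfl]
      rcases lt_trichotomy r p with hr | rfl | hr
      · have := (h1 r).1 (by omega)
        omega
      · rw [if_pos rfl]
        omega
      · have := mt (h1 r).2 (by omega)
        rw [if_neg (by omega)]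
        omega
    · rw [if_neg hc, Nat.add_zero, h1]
      split_ifs with hr
      · subst hr; omega
      · rfl

/-! ### Arcs of set partitions -/

variable {n : ℕ}

theorem mem_arcs {P : Finpartition (bracket n)} {i j : ℕ} : (i, j) ∈ arcs P ↔
    i < j ∧ ∃ B ∈ P.parts, i ∈ B ∧ j ∈ B ∧ ∀ m ∈ B, ¬ (i < m ∧ m < j) := by
  rw [arcs, Finset.mem_filter, Finset.mem_product]
  refine ⟨fun h => h.2, fun h => ⟨?_, h⟩⟩
  obtain ⟨-, B, hB, hi, hj, -⟩ := h
  exact ⟨P.le hB hi, P.le hB hj⟩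

theorem bounds_of_mem_arcs {P : Finpartition (bracket n)} {i j : ℕ} (h : (i, j) ∈ arcs P) :
    1 ≤ i ∧ i < j ∧ j ≤ n := by
  rw [arcs, Finset.mem_filter, Finset.mem_product, Finset.mem_Icc, Finset.mem_Icc] at h
  exact ⟨h.1.1.1, h.2.1, h.1.2.2⟩

theorem arcs_right_unique {P : Finpartition (bracket n)} {i j j' : ℕ} (h : (i, j) ∈ arcs P)
    (h' : (i, j') ∈ arcs P) : j = j' := by
  obtain ⟨h1, B, hB, hi, hj, hm⟩ := mem_arcs.1 h
  obtain ⟨h1', B', hB', hi', hj', hm'⟩ := mem_arcs.1 h'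
  obtain rfl := P.eq_of_mem_parts hB hB' hi hi'
  have := hm _ hj'
  have := hm' _ hj
  omega

theorem arcs_left_unique {P : Finpartition (bracket n)} {i i' j : ℕ} (h : (i, j) ∈ arcs P)
    (h' : (i', j) ∈ arcs P) : i = i' := by
  obtain ⟨h1, B, hB, hi, hj, hm⟩ := mem_arcs.1 h
  obtain ⟨h1', B', hB', hi', hj', hm'⟩ := mem_arcs.1 h'
  obtain rfl := P.eq_of_mem_parts hB hB' hj hj'
  have := hm _ hi'
  have := hm' _ hi
  omega

theorem reflTransGen_arcs {P : Finpartition (bracket n)} {B : Finset ℕ} (hB : B ∈ P.parts)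
    {i j : ℕ} (hi : i ∈ B) (hj : j ∈ B) (hij : i ≤ j) :
    Relation.ReflTransGen (fun a b => (a, b) ∈ arcs P) i j := by
  induction hd : j - i using Nat.strong_induction_on generalizing i with
  | _ d ih =>
    rcases hij.eq_or_lt with rfl | hlt
    · exact .refl
    · have hne : (B.filter fun m => i < m).Nonempty := ⟨j, Finset.mem_filter.2 ⟨hj, hlt⟩⟩
      obtain ⟨m, hm, hmin⟩ := Finset.exists_min_image _ id hne
      obtain ⟨hmB, him⟩ := Finset.mem_filter.1 hm
      have hmj : m ≤ j := hmin j (Finset.mem_filter.2 ⟨hj, hlt⟩)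
      refine .head (mem_arcs.2 ⟨him, B, hB, hi, hmB, fun l hl hlm => ?_⟩)
        (ih (j - m) (by omega) hmB hmj rfl)
      have : m ≤ l := hmin l (Finset.mem_filter.2 ⟨hl, hlm.1⟩)
      omega

theorem mem_part_of_reflTransGen {P : Finpartition (bracket n)} {B : Finset ℕ}
    (hB : B ∈ P.parts) {i j : ℕ} (hi : i ∈ B)
    (h : Relation.ReflTransGen (fun a b => (a, b) ∈ arcs P) i j) : j ∈ B := by
  induction h with
  | refl => exact hi
  | tail _ h ih =>
    obtain ⟨-, B', hB', hi', hj', -⟩ := mem_arcs.1 h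
    rwa [P.eq_of_mem_parts hB hB' ih hi']

/-- A block consists of the elements linked by arc paths to any one of its members. -/
theorem parts_subset_of_arcs_eq {P Q : Finpartition (bracket n)} (h : arcs P = arcs Q) :
    P.parts ⊆ Q.parts := by
  intro B hB
  obtain ⟨i, hi, hmin⟩ := Finset.exists_min_image B id (P.nonempty_of_mem_parts hB)
  obtain ⟨C, ⟨hC, hiC⟩, -⟩ := Q.existsUnique_mem (P.le hB hi)
  have hsub : ∀ {P Q : Finpartition (bracket n)}, arcs P = arcs Q → ∀ {B C : Finset ℕ},
      B ∈ P.parts → C ∈ Q.parts → i ∈ B → i ∈ C → ∀ j ∈ B, j ∈ C := by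
    intro P Q h B C hB hC hi hiC j hj
    rcases le_total i j with hij | hij
    · have := reflTransGen_arcs hB hi hj hij
      rw [h] at this
      exact mem_part_of_reflTransGen hC hiC this
    · have h1 := reflTransGen_arcs hB hj hi hij
      rw [h] at h1
      obtain ⟨D, ⟨hD, hjD⟩, -⟩ := Q.existsUnique_mem (P.le hB hj)
      rwa [Q.eq_of_mem_parts hC hD hiC (mem_part_of_reflTransGen hD hjD h1)]
  have : B = C := Finset.Subset.antisymm (hsub h hB hC hi hiC) (hsub h.symm hC hB hiC hi)
  rwa [this]

theorem arcs_injective {P Q : Finpartition (bracket n)} (h : arcs P = arcs Q) : P = Q :=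
  Finpartition.ext
    (Finset.Subset.antisymm (parts_subset_of_arcs_eq h) (parts_subset_of_arcs_eq h.symm))

theorem le_of_reflTransGen {A : ℕ → ℕ → Prop} (hlt : ∀ {i j}, A i j → i < j) {i j : ℕ}
    (h : Relation.ReflTransGen A i j) : i ≤ j := by
  induction h with
  | refl => exact le_rfl
  | tail _ h ih => exact ih.trans (hlt h).le

/-- The equivalence relation whose classes are the paths of `A`. -/
def pathSetoid (A : ℕ → ℕ → Prop) (hr : Relator.RightUnique A) (hl : Relator.LeftUnique A) :
    Setoid ℕ where
  r i j := Relation.ReflTransGen A i j ∨ Relation.ReflTransGen A j i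
  iseqv := by
    refine ⟨fun _ => Or.inl .refl, fun h => h.symm, ?_⟩
    rintro i j k (h | h) (h' | h')
    · exact Or.inl (h.trans h')
    -- Two paths with the same end are comparable, since predecessors are unique.
    · have := Relation.ReflTransGen.total_of_right_unique (r := Function.swap A)
        (fun a b c hab hac => hl hab hac) (Relation.reflTransGen_swap.2 h)
        (Relation.reflTransGen_swap.2 h')
      exact this.symm.imp Relation.reflTransGen_swap.1 Relation.reflTransGen_swap.1
    · exact Relation.ReflTransGen.total_of_right_unique hr h h'
    · exact Or.inr (h'.trans h)

open Classical in
/-- Every relation that looks like the arcs of a partition is one. -/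
theorem exists_arcs_eq (A : ℕ → ℕ → Prop) (hr : Relator.RightUnique A)
    (hl : Relator.LeftUnique A) (hA : ∀ {i j}, A i j → 1 ≤ i ∧ i < j ∧ j ≤ n) :
    ∃ P : Finpartition (bracket n), ∀ i j, (i, j) ∈ arcs P ↔ A i j := by
  have hlt : ∀ {i j}, A i j → i < j := fun h => (hA h).2.1
  let P := Finpartition.ofSetSetoid (pathSetoid A hr hl) (bracket n)
  have hP : ∀ {i j}, j ∈ P.part i ↔ i ∈ bracket n ∧ j ∈ bracket n ∧
      (Relation.ReflTransGen A i j ∨ Relation.ReflTransGen A j i) := by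
    intro i j
    exact Finpartition.mem_part_ofSetSetoid_iff_rel _
  refine ⟨P, fun i j => ?_⟩
  rw [mem_arcs]
  constructor
  · rintro ⟨hij, B, hB, hi, hj, hm⟩
    rw [← P.part_eq_of_mem hB hi] at hj hm
    obtain ⟨hi', hj', h | h⟩ := hP.1 hj
    · rcases Relation.ReflTransGen.cases_head h with rfl | ⟨m, him, hmj⟩
      · omega
      · have hmj' := le_of_reflTransGen hlt hmj
        rcases hmj'.eq_or_lt with rfl | hmj'
        · exact him
        · refine absurd ⟨hlt him, hmj'⟩ (hm m (hP.2 ⟨hi', ?_, Or.inl (.single him)⟩))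
          rw [Finset.mem_Icc] at *
          have := hlt him
          omega
    · have := le_of_reflTransGen hlt h
      omega
  · intro h
    have hb := hA h
    have hi : i ∈ bracket n := by rw [Finset.mem_Icc]; omega
    have hj : j ∈ bracket n := by rw [Finset.mem_Icc]; omega
    refine ⟨hb.2.1, P.part i, P.part_mem.2 hi, hP.2 ⟨hi, hi, Or.inl .refl⟩,
      hP.2 ⟨hi, hj, Or.inl (.single h)⟩, fun m hm hlm => ?_⟩
    obtain ⟨-, -, h' | h'⟩ := hP.1 hm
    · rcases Relation.ReflTransGen.cases_head h' with rfl | ⟨l, hil, hl'⟩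
      · omega
      · obtain rfl := hr hil h
        have := le_of_reflTransGen hlt hl'
        omega
    · have := le_of_reflTransGen hlt h'
      omega

/-! ### The filling of a set partition -/

/-- The arc `(i, j)` is entered in row `i - 1` and column `n - j`. -/
def filling (P : Finpartition (bracket n)) (x y : ℕ) : Prop := (x + 1, n - y) ∈ arcs P

/-- For `y ≥ n` the truncated `n - y` is `0`, which is not an endpoint of any arc. -/
theorem filling_support {P : Finpartition (bracket n)} {x y : ℕ} (h : filling P x y) :
    x + y + 1 < n := by
  have := bounds_of_mem_arcs h
  omega

theorem isPartialPerm_filling (P : Finpartition (bracket n)) : IsPartialPerm (filling P) where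
  row h h' := by
    have := arcs_right_unique h h'
    have := filling_support h
    have := filling_support h'
    omega
  col h h' := by
    have := arcs_left_unique h h'
    omega

theorem mem_arcs_iff_filling {P : Finpartition (bracket n)} {i j : ℕ} :
    (i, j) ∈ arcs P ↔ 1 ≤ i ∧ j ≤ n ∧ filling P (i - 1) (n - j) := by
  constructor
  · intro h
    have hb := bounds_of_mem_arcs h
    refine ⟨hb.1, hb.2.2, ?_⟩
    rw [filling, show i - 1 + 1 = i by omega, show n - (n - j) = j by omega]
    exact h
  · rintro ⟨h1, h2, h⟩
    rwa [filling, show i - 1 + 1 = i by omega, show n - (n - j) = j by omega] at h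

theorem filling_injective {P Q : Finpartition (bracket n)}
    (h : ∀ x y, filling P x y ↔ filling Q x y) : P = Q := by
  refine arcs_injective (Finset.ext fun ⟨i, j⟩ => ?_)
  rw [mem_arcs_iff_filling, mem_arcs_iff_filling, h]

theorem exists_filling_eq {S : ℕ → ℕ → Prop} (hS : IsPartialPerm S)
    (hsup : ∀ x y, S x y → x + y + 1 < n) :
    ∃ P : Finpartition (bracket n), ∀ x y, filling P x y ↔ S x y := by
  obtain ⟨P, hP⟩ := exists_arcs_eq (n := n) (fun i j => 1 ≤ i ∧ j ≤ n ∧ S (i - 1) (n - j))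
    (fun i j j' h h' => by have := hS.row h.2.2 h'.2.2; have := h.2.1; have := h'.2.1; omega)
    (fun i j i' h h' => by have := hS.col h.2.2 h'.2.2; have := h.1; have := h'.1; omega)
    (fun {i j} h => by have := hsup _ _ h.2.2; have := h.1; have := h.2.1; omega)
  refine ⟨P, fun x y => ?_⟩
  rw [filling, hP]
  constructor
  · rintro ⟨-, -, h⟩
    have := hsup _ _ h
    rwa [show x + 1 - 1 = x by omega, show n - (n - y) = y by omega] at h
  · intro h
    have := hsup _ _ h
    rw [show x + 1 - 1 = x by omega, show n - (n - y) = y by omega]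
    exact ⟨by omega, by omega, h⟩

/-! ### Crossings and nestings as chains -/

theorem inc_iff {S : ℕ → ℕ → Prop} {k x y : ℕ} : Inc S k x y ↔ ∃ a b : Fin k → ℕ,
    StrictMono a ∧ StrictMono b ∧ ∀ r, S (a r) (b r) ∧ a r < x ∧ b r < y := by
  induction k generalizing x y with
  | zero => exact ⟨fun _ => ⟨Fin.elim0, Fin.elim0, fun r => r.elim0, fun r => r.elim0,
      fun r => r.elim0⟩, fun _ => trivial⟩
  | succ k ih =>
    constructor
    · rintro ⟨c, d, hc, hd, hs, h⟩
      obtain ⟨a, b, ha, hb, h⟩ := ih.1 h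
      refine ⟨Fin.snoc (α := fun _ => ℕ) a c, Fin.snoc (α := fun _ => ℕ) b d, ?_, ?_, ?_⟩
      · intro r s hrs
        induction s using Fin.lastCases with
        | last =>
          induction r using Fin.lastCases with
          | last => exact absurd hrs (lt_irrefl _)
          | cast r => simpa using (h r).2.1
        | cast s =>
          induction r using Fin.lastCases with
          | last => exact absurd hrs (not_lt.2 (Fin.le_last _))
          | cast r => simpa using ha (Fin.castSucc_lt_castSucc_iff.1 hrs)
      · intro r s hrs
        induction s using Fin.lastCases with
        | last =>
          induction r using Fin.lastCases with
          | last => exact absurd hrs (lt_irrefl _)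
          | cast r => simpa using (h r).2.2
        | cast s =>
          induction r using Fin.lastCases with
          | last => exact absurd hrs (not_lt.2 (Fin.le_last _))
          | cast r => simpa using hb (Fin.castSucc_lt_castSucc_iff.1 hrs)
      · intro r
        induction r using Fin.lastCases with
        | last => simpa using ⟨hs, hc, hd⟩
        | cast r =>
          have := h r
          simp only [Fin.snoc_castSucc]
          exact ⟨this.1, by omega, by omega⟩
    · rintro ⟨a, b, ha, hb, h⟩
      refine ⟨a (Fin.last k), b (Fin.last k), (h _).2.1, (h _).2.2, (h _).1,
        ih.2 ⟨fun r => a r.castSucc, fun r => b r.castSucc, ?_, ?_, fun r => ⟨(h _).1, ?_, ?_⟩⟩⟩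
      · exact ha.comp Fin.strictMono_castSucc
      · exact hb.comp Fin.strictMono_castSucc
      · exact ha (Fin.castSucc_lt_last r)
      · exact hb (Fin.castSucc_lt_last r)

theorem dec_iff {S : ℕ → ℕ → Prop} {X k l y : ℕ} : Dec S X k l y ↔ ∃ a b : Fin k → ℕ,
    StrictMono a ∧ StrictAnti b ∧ ∀ r, S (a r) (b r) ∧ l ≤ a r ∧ a r < X ∧ b r < y := by
  induction k generalizing l y with
  | zero => exact ⟨fun _ => ⟨Fin.elim0, Fin.elim0, fun r => r.elim0, fun r => r.elim0,
      fun r => r.elim0⟩, fun _ => trivial⟩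
  | succ k ih =>
    constructor
    · rintro ⟨c, d, hl, hc, hd, hs, h⟩
      obtain ⟨a, b, ha, hb, h⟩ := ih.1 h
      refine ⟨Fin.cons (α := fun _ => ℕ) c a, Fin.cons (α := fun _ => ℕ) d b, ?_, ?_, ?_⟩
      · intro r s hrs
        induction r using Fin.cases with
        | zero =>
          induction s using Fin.cases with
          | zero => exact absurd hrs (lt_irrefl _)
          | succ s => simpa using (h s).2.1
        | succ r =>
          induction s using Fin.cases with
          | zero => exact absurd hrs (not_lt.2 (Fin.zero_le _))
          | succ s => simpa using ha (Fin.succ_lt_succ_iff.1 hrs)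
      · intro r s hrs
        induction r using Fin.cases with
        | zero =>
          induction s using Fin.cases with
          | zero => exact absurd hrs (lt_irrefl _)
          | succ s => simpa using (h s).2.2.2
        | succ r =>
          induction s using Fin.cases with
          | zero => exact absurd hrs (not_lt.2 (Fin.zero_le _))
          | succ s => simpa using hb (Fin.succ_lt_succ_iff.1 hrs)
      · intro r
        induction r using Fin.cases with
        | zero => simpa using ⟨hs, hl, hc, hd⟩
        | succ r =>
          have := h r
          simp only [Fin.cons_succ]
          exact ⟨this.1, by omega, by omega, by omega⟩
    · rintro ⟨a, b, ha, hb, h⟩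
      refine ⟨a 0, b 0, (h _).2.1, (h _).2.2.1, (h _).2.2.2, (h _).1,
        ih.2 ⟨fun r => a r.succ, fun r => b r.succ, ?_, ?_,
          fun r => ⟨(h _).1, ?_, (h _).2.2.1, ?_⟩⟩⟩
      · exact ha.comp (Fin.strictMono_succ)
      · exact hb.comp_strictMono (Fin.strictMono_succ)
      · exact ha (Fin.succ_pos r)
      · exact hb (Fin.succ_pos r)

theorem hasNesting_iff {P : Finpartition (bracket n)} {k : ℕ} :
    HasNesting P k ↔ ∃ x y, x + y = n ∧ Inc (filling P) k x y := by
  constructor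
  · rintro ⟨i, j, h, hi, hj, hij⟩
    cases k with
    | zero => exact ⟨n, 0, rfl, trivial⟩
    | succ k =>
      have hb := fun r => bounds_of_mem_arcs (h r)
      -- All arcs pass over the gap after the last left endpoint, so the rectangle of that corner
      -- contains them.
      have hlast := hb (Fin.last k)
      refine ⟨i (Fin.last k), n - i (Fin.last k), by omega,
        inc_iff.2 ⟨fun r => i r - 1, fun r => n - j r, ?_, ?_, fun r => ⟨?_, ?_, ?_⟩⟩⟩
      · intro r s hrs
        have := hi hrs
        have := hb r
        dsimp only
        omega
      · intro r s hrs
        have := hj hrs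
        have := hb r
        dsimp only
        omega
      · exact (mem_arcs_iff_filling.1 (h r)).2.2
      · have := hi.monotone (Fin.le_last r)
        have := hb r
        dsimp only
        omega
      · have := hij (Fin.last k) r
        have := hb r
        dsimp only
        omega
  · rintro ⟨x, y, hxy, h⟩
    obtain ⟨a, b, ha, hb, h⟩ := inc_iff.1 h
    have hs := fun r => filling_support (h r).1
    refine ⟨fun r => a r + 1, fun r => n - b r, fun r => (h r).1, ?_, ?_, ?_⟩
    · intro r s hrs
      have := ha hrs
      dsimp only
      omega
    · intro r s hrs
      have := hb hrs
      have := hs s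
      dsimp only
      omega
    · intro r s
      have := h r
      have := h s
      dsimp only
      omega

theorem hasCrossing_iff {P : Finpartition (bracket n)} {k : ℕ} :
    HasCrossing P k ↔ ∃ x y, x + y = n ∧ Dec (filling P) x k 0 y := by
  constructor
  · rintro ⟨i, j, h, hi, hj, hij⟩
    cases k with
    | zero => exact ⟨n, 0, rfl, trivial⟩
    | succ k =>
      have hb := fun r => bounds_of_mem_arcs (h r)
      have hlast := hb (Fin.last k)
      refine ⟨i (Fin.last k), n - i (Fin.last k), by omega,
        dec_iff.2 ⟨fun r => i r - 1, fun r => n - j r, ?_, ?_, fun r => ⟨?_, Nat.zero_le _, ?_, ?_⟩⟩⟩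
      · intro r s hrs
        have := hi hrs
        have := hb r
        dsimp only
        omega
      · intro r s hrs
        have := hj hrs
        have := hb s
        dsimp only
        omega
      · exact (mem_arcs_iff_filling.1 (h r)).2.2
      · have := hi.monotone (Fin.le_last r)
        have := hb r
        dsimp only
        omega
      · have := hij (Fin.last k) r
        have := hb r
        dsimp only
        omega
  · rintro ⟨x, y, hxy, h⟩
    obtain ⟨a, b, ha, hb, h⟩ := dec_iff.1 h
    have hs := fun r => filling_support (h r).1
    refine ⟨fun r => a r + 1, fun r => n - b r, fun r => (h r).1, ?_, ?_, ?_⟩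
    · intro r s hrs
      have := ha hrs
      dsimp only
      omega
    · intro r s hrs
      have := hb hrs
      have := hs r
      dsimp only
      omega
    · intro r s
      have := h r
      have := h s
      dsimp only
      omega

theorem HasNesting.mono {P : Finpartition (bracket n)} {k l : ℕ} (h : HasNesting P l)
    (hkl : k ≤ l) : HasNesting P k := by
  obtain ⟨i, j, h, hi, hj, hij⟩ := h
  exact ⟨i ∘ Fin.castLE hkl, j ∘ Fin.castLE hkl, fun r => h _,
    hi.comp (Fin.strictMono_castLE hkl), hj.comp_strictMono (Fin.strictMono_castLE hkl),
    fun r s => hij _ _⟩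

theorem HasCrossing.mono {P : Finpartition (bracket n)} {k l : ℕ} (h : HasCrossing P l)
    (hkl : k ≤ l) : HasCrossing P k := by
  obtain ⟨i, j, h, hi, hj, hij⟩ := h
  exact ⟨i ∘ Fin.castLE hkl, j ∘ Fin.castLE hkl, fun r => h _,
    hi.comp (Fin.strictMono_castLE hkl), hj.comp (Fin.strictMono_castLE hkl),
    fun r s => hij _ _⟩

theorem ne_lt_iff {P : Finpartition (bracket n)} {k : ℕ} : ne P < k ↔ ¬ HasNesting P k :=
  ⟨fun h hn => absurd ((isGreatest_ne P).2 hn) (not_le.2 h),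
    fun h => not_le.1 fun hn => h ((isGreatest_ne P).1.mono hn)⟩

theorem cr_lt_iff {P : Finpartition (bracket n)} {k : ℕ} : cr P < k ↔ ¬ HasCrossing P k :=
  ⟨fun h hn => absurd ((isGreatest_cr P).2 hn) (not_le.2 h),
    fun h => not_le.1 fun hn => h ((isGreatest_cr P).1.mono hn)⟩

/-! ### Border partitions and their conjugation -/

theorem isNonnesting_iff {P : Finpartition (bracket n)} {k : ℕ} :
    IsNonnesting k P ↔ ∀ x y, x + y = n → ¬ k ≤ grow (filling P) x y 0 := by
  simp only [IsNonnesting, ne_lt_iff, hasNesting_iff, le_grow_zero_iff (isPartialPerm_filling P)]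
  push Not
  rfl

/-- Rows are indexed from `0`: row `k` is empty exactly when there are at most `k` parts. -/
theorem isNoncrossing_iff {P : Finpartition (bracket n)} {k : ℕ} :
    IsNoncrossing (k + 1) P ↔ ∀ x y, x + y = n → ¬ 0 < grow (filling P) x y k := by
  simp only [IsNoncrossing, cr_lt_iff, hasCrossing_iff, grow_pos_iff (isPartialPerm_filling P)]
  push Not
  rfl

/-- `Q` has the conjugate partitions of those of `P` on the border of its growth diagram. -/
def IsConjugate (P Q : Finpartition (bracket n)) : Prop :=
  ∀ x y, x + y = n ∨ x + y + 1 = n → grow (filling Q) x y = conj (grow (filling P) x y)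

theorem exists_isConjugate (P : Finpartition (bracket n)) : ∃ Q, IsConjugate P Q := by
  cases n with
  | zero =>
    refine ⟨P, fun x y h => ?_⟩
    obtain rfl : x = 0 := by omega
    rw [grow_zero_left, conj_zero]
  | succ d =>
    have hP := isPartialPerm_filling P
    have h0 : ∀ x y, grow (filling P) x y x = 0 := fun x y => grow_eq_zero le_rfl
    have ha := fun x y => (growInv hP x y).antitone
    obtain ⟨S, hS, hsup, hg⟩ := exists_grow_eq d (fun x y => conj (grow (filling P) x y))
      (fun x y _ => conj_antitone (ha x y) (h0 x y)) (fun y _ => by simp [conj_zero])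
      (fun x y _ => (growInv hP x y).adj_left.conj (ha _ _) (ha _ _) (h0 _ _))
      (fun x y _ => (growInv hP x y).adj_right.conj (ha _ _) (ha _ _) (h0 _ _))
    obtain ⟨Q, hQ⟩ := exists_filling_eq (n := d + 1) hS fun x y h => by
      have := hsup x y h
      omega
    refine ⟨Q, fun x y h => ?_⟩
    rw [show filling Q = S from funext fun x => funext fun y => propext (hQ x y)]
    exact hg x y (by omega)

theorem IsConjugate.injective {P P' Q : Finpartition (bracket n)} (h : IsConjugate P Q)
    (h' : IsConjugate P' Q) : P = P' := by
  have hP := isPartialPerm_filling P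
  have hP' := isPartialPerm_filling P'
  refine filling_injective fun x y => ?_
  by_cases hxy : x + y + 1 < n
  · obtain ⟨d, rfl⟩ : ∃ d, n = d + 1 := ⟨n - 1, by omega⟩
    -- With `n = d + 1` the two border diagonals are `d` and `d + 1`.
    refine grow_injective hP hP' (d := d) (fun x y hd => ?_) (by omega)
    exact conj_injective (growInv hP x y).antitone (growInv hP' x y).antitone
      (grow_eq_zero le_rfl) (grow_eq_zero le_rfl)
      ((h x y (by omega)).symm.trans (h' x y (by omega)))
  · exact ⟨fun hs => absurd (filling_support hs) hxy, fun hs => absurd (filling_support hs) hxy⟩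

theorem IsConjugate.isNonnesting_iff {P Q : Finpartition (bracket n)} (h : IsConjugate P Q)
    (k : ℕ) : IsNonnesting (k + 1) Q ↔ IsNoncrossing (k + 1) P := by
  rw [SetPartition.isNonnesting_iff, isNoncrossing_iff]
  refine forall₃_congr fun x y hxy => not_congr ?_
  rw [h x y (Or.inl hxy), Nat.succ_le_iff, lt_conj_iff
    (growInv (isPartialPerm_filling P) x y).antitone (grow_eq_zero le_rfl)]

theorem IsConjugate.isNoncrossing_iff {P Q : Finpartition (bracket n)} (h : IsConjugate P Q)
    (k : ℕ) : IsNoncrossing (k + 1) Q ↔ IsNonnesting (k + 1) P := by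
  rw [SetPartition.isNonnesting_iff, SetPartition.isNoncrossing_iff]
  refine forall₃_congr fun x y hxy => not_congr ?_
  rw [h x y (Or.inl hxy), Nat.succ_le_iff, lt_conj_iff
    (growInv (isPartialPerm_filling P) x y).antitone (grow_eq_zero le_rfl)]

end SetPartition

open SetPartition in
theorem corollary1p3 (n k : ℕ) : SetPartition.NC k n = SetPartition.NN k n := by
  classical
  cases k with
  -- No number is below `0`, so both counts vanish.
  | zero => simp [NC, NN, IsNoncrossing, IsNonnesting]
  | succ k =>
    choose T hT using fun P : Finpartition (bracket n) => exists_isConjugate P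
    have hinj : Function.Injective T := fun P P' h =>
      (hT P).injective (h ▸ hT P')
    -- The same injection maps each of the two families into the other.
    refine le_antisymm (Finset.card_le_card_of_injOn T (fun P hP => ?_) hinj.injOn)
      (Finset.card_le_card_of_injOn T (fun P hP => ?_) hinj.injOn)
    · simp only [Finset.coe_filter, Finset.mem_univ, true_and, Set.mem_ofPred_eq] at hP ⊢
      exact ((hT P).isNonnesting_iff k).2 hP
    · simp only [Finset.coe_filter, Finset.mem_univ, true_and, Set.mem_ofPred_eq] at hP ⊢
      exact ((hT P).isNoncrossing_iff k).2 hP
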